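/- Let $d\ge 2$ and let $P\subset\mathbb{R}^n$ be a $d$-polytope, that is, the convex hull of a finite set of points whose affine hull has dimension $d$. A face of $P$ is $P$ itself or the intersection of $P$ with a hyperplane that contains $P$ in one of its closed halfspaces; vertices, edges and $2$-faces are the faces of dimension $0$, $1$ and $2$. Let $G(P)$ be the graph formed by the vertices and edges of $P$. A cycle of $G(P)$ is facial if it bounds a $2$-face $F$ of $P$, that is, if its edges are exactly the edges of $F$. The cycle space of $G(P)$ is the vector space over $GF(2)$ of all spanning subgraphs of $G(P)$ in which every vertex has even degree, with symmetric difference of edge sets as addition; a cycle is regarded as an element of it by adding isolated vertices. Then the cycle space of $G(P)$ is the linear span over $GF(2)$ of the facial cycles of $P$. -/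

import Mathlib

namespace PolytopeGraph

section Polytopes

variable {E : Type*} [NormedAddCommGroup E] [NormedSpace ℝ E]

/-- A (convex) polytope: the convex hull of a finite set of points. -/
def IsPolytope (P : Set E) : Prop :=
  ∃ X : Finset E, P = convexHull ℝ (X : Set E)

/-- `A` is nonempty and its affine hull has dimension `k`. -/
def HasDim (k : ℕ) (A : Set E) : Prop :=
  A.Nonempty ∧ Module.finrank ℝ (vectorSpan ℝ A) = k

/-- A `d`-polytope. -/
def IsDPolytope (d : ℕ) (P : Set E) : Prop :=
  IsPolytope P ∧ HasDim d P

/-- A face of `P`: `P` itself, or the intersection of `P` with a hyperplane `{x | l x = c}` that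
contains `P` in one of its closed halfspaces. -/
def IsFace (P F : Set E) : Prop :=
  F = P ∨ ∃ (l : StrongDual ℝ E) (c : ℝ), l ≠ 0 ∧ (∀ x ∈ P, l x ≤ c) ∧ F = {x ∈ P | l x = c}

/-- A `k`-face of `P`: a face of dimension `k`. -/
def IsKFace (k : ℕ) (P F : Set E) : Prop :=
  IsFace P F ∧ HasDim k F

/-- The vertices of `P`: the points `v` such that `{v}` is a face of dimension `0`. -/
def Vertex (P : Set E) : Type _ :=
  {v : E // IsKFace 0 P {v}}

/-- The graph of `P`: two vertices are adjacent iff the segment between them is an edge of `P`,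
that is, a face of dimension `1`. -/
def graph (P : Set E) : SimpleGraph (Vertex P) where
  Adj v w := IsKFace 1 P (segment ℝ v.1 w.1)
  symm := ⟨fun v w h => by rw [segment_symm]; exact h⟩
  loopless := ⟨fun v h => by
    have h2 := h.2.2
    rw [segment_same, vectorSpan_singleton] at h2
    simp at h2⟩

end Polytopes

section CycleSpace

variable {V : Type*}

/-- Every vertex has (finite) even degree. -/
def IsEven (H : SimpleGraph V) : Prop :=
  ∀ v, (H.neighborSet v).Finite ∧ Even (H.neighborSet v).ncard

open Classical in
/-- The spanning subgraph `H` of `G` as a vector over `GF(2)`: the indicator function of its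
edge set. -/
noncomputable def edgeVec (G H : SimpleGraph V) : G.edgeSet → ZMod 2 :=
  fun e => if (e : Sym2 V) ∈ H.edgeSet then 1 else 0

/-- Addition over `GF(2)` is the symmetric difference of spanning subgraphs. -/
theorem edgeVec_symmDiff (G H K : SimpleGraph V) :
    edgeVec G (symmDiff H K) = edgeVec G H + edgeVec G K := by
  funext ⟨e, he⟩
  induction e with | _ a b =>
  by_cases h : H.Adj a b <;> by_cases k : K.Adj a b <;>
    simp [edgeVec, symmDiff, h, k, CharTwo.add_self_eq_zero]

theorem IsEven.symmDiff {H K : SimpleGraph V} (hH : IsEven H) (hK : IsEven K) :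
    IsEven (symmDiff H K) := by
  intro v
  obtain ⟨fH, eH⟩ := hH v
  obtain ⟨fK, eK⟩ := hK v
  have hN : (_root_.symmDiff H K).neighborSet v =
      (H.neighborSet v \ K.neighborSet v) ∪ (K.neighborSet v \ H.neighborSet v) := by
    ext w
    simp [_root_.symmDiff]
  have f1 : (H.neighborSet v \ K.neighborSet v).Finite := fH.sdiff
  have f2 : (K.neighborSet v \ H.neighborSet v).Finite := fK.sdiff
  refine ⟨hN ▸ f1.union f2, ?_⟩
  rw [hN, Set.ncard_union_eq (disjoint_sdiff_sdiff) f1 f2]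
  have h1 := Set.ncard_inter_add_ncard_sdiff_eq_ncard (H.neighborSet v) (K.neighborSet v) fH
  have h2 := Set.ncard_inter_add_ncard_sdiff_eq_ncard (K.neighborSet v) (H.neighborSet v) fK
  rw [Set.inter_comm] at h2
  grind

/-- The cycle space of `G` over `GF(2)`: the even spanning subgraphs of `G`. -/
noncomputable def cycleSpace (G : SimpleGraph V) : Submodule (ZMod 2) (G.edgeSet → ZMod 2) where
  carrier := {x | ∃ H : SimpleGraph V, H ≤ G ∧ IsEven H ∧ x = edgeVec G H}
  zero_mem' := ⟨⊥, bot_le, fun v => by simp, by funext e; simp [edgeVec]⟩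
  add_mem' := by
    rintro _ _ ⟨H, hH, eH, rfl⟩ ⟨K, hK, eK, rfl⟩
    exact ⟨symmDiff H K, symmDiff_le_sup.trans (sup_le hH hK), eH.symmDiff eK,
      (edgeVec_symmDiff G H K).symm⟩
  smul_mem' := by
    rintro c _ ⟨H, hH, eH, rfl⟩
    obtain rfl | rfl : c = 0 ∨ c = 1 := by revert c; decide
    · exact ⟨⊥, bot_le, fun v => by simp, by funext e; simp [edgeVec]⟩
    · exact ⟨H, hH, eH, by simp⟩

end CycleSpace

section FacialCycles

variable {E : Type*} [NormedAddCommGroup E] [NormedSpace ℝ E]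

/-- A closed walk in the graph of `P` is a facial cycle if it is a cycle and bounds some 2-face `F`
of `P`: its edges are exactly the edges of `F`. -/
def IsFacialCycle (P : Set E) {u : Vertex P} (C : (graph P).Walk u u) : Prop :=
  C.IsCycle ∧ ∃ F : Set E, IsKFace 2 P F ∧
    ∀ v w : Vertex P, s(v, w) ∈ C.edges ↔ IsKFace 1 F (segment ℝ v.1 w.1)

/-- The facial cycles of `P`, as spanning subgraphs of the graph of `P` (with isolated vertices
added), viewed as vectors over `GF(2)`. -/
def facialCycles (P : Set E) : Set ((graph P).edgeSet → ZMod 2) :=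
  {x | ∃ (u : Vertex P) (C : (graph P).Walk u u), IsFacialCycle P C ∧
    x = edgeVec (graph P) C.toSubgraph.spanningCoe}

end FacialCycles

end PolytopeGraph

/-! The proof sweeps the polytope with a generic linear functional `φ`, injective on the vertices
and on the projections of the points from each vertex. Let `v` be the highest non-isolated vertex of
an even subgraph. All its edges at `v` descend, and their number is even. It therefore suffices that
any two descending edges at `v` agree modulo facial cycles and edges lying strictly below `v`: then
the edges at `v` cancel in pairs, and induction on height finishes (`cycleSpace_eq_of_exchange`).

For the exchange, pass to the vertex figure at `v`. Its vertices are the edges of the polytope at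
`v`, its edges come from 2-faces through `v`, and descending edges are the vertices where `φ` is
negative. As in the simplex method, a `φ`-decreasing path leads from each of them to a common
minimum and stays where `φ` is negative (`IsVertexFigure.exists_reflTransGen`). Each step of the
path is a 2-face with both of its edges at `v` descending. Then `v` is the top of this 2-face, and
its boundary cycle consists of these two edges and edges below `v`
(`ConvexPosition.edgeIndicator_sub_mem`). -/

namespace PolytopeGraph

/-! ### Faces of a polytope as subsets of a finite set in convex position -/

section ConvexGeometry

variable {E : Type*} [NormedAddCommGroup E] [NormedSpace ℝ E]

/-- Every point of `X` is the unique maximiser on `X` of some continuous linear functional. -/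
def ConvexPosition (X : Set E) : Prop :=
  ∀ v ∈ X, ∃ l : StrongDual ℝ E, ∀ x ∈ X, x ≠ v → l x < l v

/-- `S` is the nonempty set of maximisers on `X` of some continuous linear functional. -/
def IsFaceSet (X S : Set E) : Prop :=
  S.Nonempty ∧ ∃ (l : StrongDual ℝ E) (c : ℝ), (∀ x ∈ X, l x ≤ c) ∧ S = {x ∈ X | l x = c}

/-- `{v, w}` is a face set of `X` with two elements. -/
def IsEdgeSet (X : Set E) (v w : E) : Prop :=
  v ≠ w ∧ IsFaceSet X {v, w}

theorem IsFaceSet.subset {X S : Set E} (h : IsFaceSet X S) : S ⊆ X := by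
  obtain ⟨-, l, c, -, rfl⟩ := h
  exact Set.sep_subset _ _

theorem IsEdgeSet.symm {X : Set E} {v w : E} (h : IsEdgeSet X v w) : IsEdgeSet X w v :=
  ⟨h.1.symm, by rw [Set.pair_comm]; exact h.2⟩

theorem IsEdgeSet.left_mem {X : Set E} {v w : E} (h : IsEdgeSet X v w) : v ∈ X :=
  h.2.subset (by simp)

theorem IsEdgeSet.right_mem {X : Set E} {v w : E} (h : IsEdgeSet X v w) : w ∈ X :=
  h.2.subset (by simp)

theorem ConvexPosition.mono {X Y : Set E} (hY : ConvexPosition Y) (h : X ⊆ Y) :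
    ConvexPosition X := fun v hv => by
  obtain ⟨l, hl⟩ := hY v (h hv)
  exact ⟨l, fun x hx => hl x (h hx)⟩

theorem lt_of_mem_convexHull {X : Set E} (l : StrongDual ℝ E) {c : ℝ} (h : ∀ x ∈ X, l x < c)
    {x : E} (hx : x ∈ convexHull ℝ X) : l x < c :=
  convexHull_min (t := {x | l x < c}) h (convex_halfSpace_lt l.isLinear c) hx

theorem le_of_mem_convexHull {X : Set E} (l : StrongDual ℝ E) {c : ℝ} (h : ∀ x ∈ X, l x ≤ c)
    {x : E} (hx : x ∈ convexHull ℝ X) : l x ≤ c :=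
  convexHull_min (t := {x | l x ≤ c}) h (convex_halfSpace_le l.isLinear c) hx

theorem eq_of_mem_convexHull {X : Set E} (l : StrongDual ℝ E) {c : ℝ} (h : ∀ x ∈ X, l x = c)
    {x : E} (hx : x ∈ convexHull ℝ X) : l x = c :=
  convexHull_min (t := {x | l x = c}) h (convex_hyperplane l.isLinear c) hx

theorem ConvexPosition.mem_of_mem_convexHull {X T : Set E} (hX : ConvexPosition X) (hT : T ⊆ X)
    {v : E} (hv : v ∈ X) (h : v ∈ convexHull ℝ T) : v ∈ T := by
  by_contra hvT
  obtain ⟨l, hl⟩ := hX v hv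
  exact lt_irrefl _ (lt_of_mem_convexHull l
    (fun x hx => hl x (hT hx) (fun e => hvT (e ▸ hx))) h)

/-- In a minimal subset with the same hull no point lies in the hull of the others, so Hahn–Banach
separates it from them. -/
theorem exists_convexPosition_subset {Y : Set E} (hY : Y.Finite) :
    ∃ X ⊆ Y, ConvexPosition X ∧ convexHull ℝ X = convexHull ℝ Y := by
  have hfin : {X : Set E | X ⊆ Y ∧ convexHull ℝ X = convexHull ℝ Y}.Finite :=
    hY.finite_subsets.subset fun X hX => hX.1
  obtain ⟨X, ⟨hXY, hconv⟩, hmin⟩ := hfin.exists_minimal ⟨Y, subset_rfl, rfl⟩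
  refine ⟨X, hXY, fun v hv => ?_, hconv⟩
  have hX' : (X \ {v}).Finite := (hY.subset hXY).subset Set.sdiff_subset
  have hnot : v ∉ convexHull ℝ (X \ {v}) := by
    intro hmem
    have h1 : X ⊆ convexHull ℝ (X \ {v}) := by
      intro x hx
      by_cases hxv : x = v
      · exact hxv ▸ hmem
      · exact subset_convexHull ℝ _ ⟨hx, hxv⟩
    have h2 : convexHull ℝ (X \ {v}) = convexHull ℝ X :=
      (convexHull_mono Set.sdiff_subset).antisymm (convexHull_min h1 (convex_convexHull ℝ _))
    exact (hmin ⟨Set.sdiff_subset.trans hXY, h2.trans hconv⟩ Set.sdiff_subset hv).2 rfl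
  obtain ⟨l, u, h1, h2⟩ :=
    geometric_hahn_banach_closed_point (convex_convexHull ℝ _) (hX'.isClosed_convexHull ℝ) hnot
  exact ⟨l, fun x hx hxv => (h1 x (subset_convexHull ℝ _ ⟨hx, hxv⟩)).trans h2⟩

/-- The open halfspace `l < c` together with the hull of the contact points is convex and contains
`X`. Hence faces of the hull are encoded by subsets of `X`. -/
theorem convexHull_sep_eq {X : Set E} (l : StrongDual ℝ E) {c : ℝ} (h : ∀ x ∈ X, l x ≤ c) :
    convexHull ℝ {x ∈ X | l x = c} = {x ∈ convexHull ℝ X | l x = c} := by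
  apply Set.Subset.antisymm
  · intro x hx
    exact ⟨convexHull_mono (Set.sep_subset _ _) hx, eq_of_mem_convexHull l (fun x hx => hx.2) hx⟩
  · rintro x ⟨hx, hxc⟩
    have hS : ∀ y ∈ convexHull ℝ {x ∈ X | l x = c}, l y = c :=
      fun y => eq_of_mem_convexHull l (fun x hx => hx.2)
    have key : convexHull ℝ X ⊆ {x | l x < c} ∪ convexHull ℝ {x ∈ X | l x = c} := by
      apply convexHull_min
      · intro y hy
        rcases (h y hy).lt_or_eq with h1 | h1
        · exact Or.inl h1
        · exact Or.inr (subset_convexHull ℝ _ ⟨hy, h1⟩)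
      · rw [convex_iff_forall_pos]
        intro y hy z hz a b ha hb hab
        have hle : ∀ u ∈ {x | l x < c} ∪ convexHull ℝ {x ∈ X | l x = c}, l u ≤ c := by
          rintro u (hu | hu)
          · exact le_of_lt hu
          · exact (hS u hu).le
        by_cases hyz : l y < c ∨ l z < c
        · left
          have h1 := hle y hy
          have h2 := hle z hz
          simp only [Set.mem_ofPred_eq, map_add, map_smul, smul_eq_mul]
          obtain rfl : b = 1 - a := by linarith
          rcases hyz with h3 | h3 <;> nlinarith
        · push Not at hyz
          right
          refine convex_convexHull ℝ _ ?_ ?_ ha.le hb.le hab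
          · exact hy.resolve_left (not_lt.2 hyz.1)
          · exact hz.resolve_left (not_lt.2 hyz.2)
    exact (key hx).resolve_left (fun h => h.ne hxc)

theorem vectorSpan_convexHull (X : Set E) : vectorSpan ℝ (convexHull ℝ X) = vectorSpan ℝ X := by
  rw [← direction_affineSpan, affineSpan_convexHull, direction_affineSpan]

theorem IsFaceSet.of_subset {X S T : Set E} (hT : IsFaceSet X T) (hTS : T ⊆ S) (hS : S ⊆ X) :
    IsFaceSet S T := by
  obtain ⟨h0, l, c, hl, rfl⟩ := hT
  refine ⟨h0, l, c, fun x hx => hl x (hS hx), ?_⟩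
  ext x
  exact ⟨fun hx => ⟨hTS hx, hx.2⟩, fun hx => ⟨hS hx.1, hx.2⟩⟩

/-- Adding a large multiple of the functional that exposes `S` to the one that exposes `T` in `S`
penalises every point outside `S`; finiteness makes one multiple enough. -/
theorem IsFaceSet.trans {X S T : Set E} (hfin : X.Finite) (hS : IsFaceSet X S)
    (hT : IsFaceSet S T) : IsFaceSet X T := by
  have hTX := hT.subset.trans hS.subset
  obtain ⟨-, l, c, hl, rfl⟩ := hS
  obtain ⟨h0, m, b, hm, rfl⟩ := hT
  -- Off the face, `m x - b ≤ N * (c - l x)`, and `N + 1` makes this strict. On the face the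
  -- quotient is `0` by convention, which is harmless.
  obtain ⟨N, hN⟩ := (hfin.image (fun x => (m x - b) / (c - l x))).bddAbove
  have key : ∀ x ∈ X, l x ≠ c → (m + (N + 1) • l) x < b + (N + 1) * c := by
    intro x hx hxc
    have h1 : 0 < c - l x := sub_pos.2 ((hl x hx).lt_of_ne hxc)
    have h2 := hN ⟨x, hx, rfl⟩
    rw [div_le_iff₀ h1] at h2
    simp only [add_apply, smul_apply, smul_eq_mul]
    nlinarith
  have key2 : ∀ x, l x = c → (m + (N + 1) • l) x = m x + (N + 1) * c := by
    intro x hx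
    simp [hx]
  refine ⟨h0, m + (N + 1) • l, b + (N + 1) * c, fun x hx => ?_, ?_⟩
  · by_cases hxc : l x = c
    · rw [key2 x hxc]
      linarith [hm x ⟨hx, hxc⟩]
    · exact (key x hx hxc).le
  · ext x
    refine ⟨fun hx => ⟨hx.1.1, by rw [key2 x hx.1.2, hx.2]⟩, fun hx => ?_⟩
    have hxc : l x = c := by
      by_contra hxc
      exact (key x hx.1 hxc).ne hx.2
    refine ⟨⟨hx.1, hxc⟩, ?_⟩
    have := hx.2
    rw [key2 x hxc] at this
    linarith

theorem isFace_iff_of_nonempty {P F : Set E} (hF : F.Nonempty) :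
    IsFace P F ↔ ∃ (l : StrongDual ℝ E) (c : ℝ), (∀ x ∈ P, l x ≤ c) ∧ F = {x ∈ P | l x = c} := by
  constructor
  · rintro (rfl | ⟨l, c, -, h⟩)
    · exact ⟨0, 0, by simp, by simp⟩
    · exact ⟨l, c, h⟩
  · rintro ⟨l, c, h, rfl⟩
    by_cases hl : l = 0
    · subst hl
      obtain ⟨x, hx, hc⟩ := hF
      left
      ext y
      simp only [zero_apply] at hc
      simp [← hc]
    · exact Or.inr ⟨l, c, hl, h, rfl⟩

theorem isKFace_convexHull_iff {k : ℕ} {X F : Set E} :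
    IsKFace k (convexHull ℝ X) F ↔
      ∃ S, IsFaceSet X S ∧ Module.finrank ℝ (vectorSpan ℝ S) = k ∧ F = convexHull ℝ S := by
  constructor
  · rintro ⟨hF, h0, hk⟩
    obtain ⟨l, c, hl, rfl⟩ := (isFace_iff_of_nonempty h0).1 hF
    have hl' : ∀ x ∈ X, l x ≤ c := fun x hx => hl x (subset_convexHull ℝ _ hx)
    rw [← convexHull_sep_eq l hl'] at h0 hk ⊢
    rw [vectorSpan_convexHull] at hk
    exact ⟨_, ⟨(convexHull_nonempty_iff (𝕜 := ℝ)).1 h0, l, c, hl', rfl⟩, hk, rfl⟩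
  · rintro ⟨S, ⟨h0, l, c, hl, rfl⟩, hk, rfl⟩
    have h1 := (convexHull_nonempty_iff (𝕜 := ℝ)).2 h0
    refine ⟨(isFace_iff_of_nonempty h1).2
      ⟨l, c, fun x => le_of_mem_convexHull l hl, convexHull_sep_eq l hl⟩, h1, ?_⟩
    rw [vectorSpan_convexHull, hk]

theorem ConvexPosition.isFaceSet_singleton {X : Set E} (hX : ConvexPosition X) {v : E}
    (hv : v ∈ X) : IsFaceSet X {v} := by
  obtain ⟨l, hl⟩ := hX v hv
  refine ⟨by simp, l, l v, fun x hx => ?_, ?_⟩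
  · by_cases h : x = v
    · rw [h]
    · exact (hl x hx h).le
  · ext x
    refine ⟨fun h => ?_, fun h => ?_⟩
    · obtain rfl : x = v := h
      exact ⟨hv, rfl⟩
    · by_contra h1
      exact (hl x h.1 h1).ne h.2

theorem ConvexPosition.isKFace_zero_iff {X : Set E} (hX : ConvexPosition X) {v : E} :
    IsKFace 0 (convexHull ℝ X) {v} ↔ v ∈ X := by
  rw [isKFace_convexHull_iff]
  constructor
  · rintro ⟨S, hS, -, h⟩
    obtain ⟨x, hx⟩ := hS.1
    have : x ∈ ({v} : Set E) := h ▸ subset_convexHull ℝ _ hx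
    obtain rfl : x = v := this
    exact hS.subset hx
  · intro hv
    exact ⟨{v}, hX.isFaceSet_singleton hv, by simp, by simp⟩

theorem finrank_vectorSpan_pair {v w : E} (h : v ≠ w) :
    Module.finrank ℝ (vectorSpan ℝ {v, w}) = 1 := by
  rw [vectorSpan_pair]
  exact finrank_span_singleton (by simpa [sub_eq_zero] using h)

theorem ConvexPosition.isKFace_one_iff {X S : Set E} (hX : ConvexPosition X) (hS : S ⊆ X)
    {v w : E} (hv : v ∈ X) (hw : w ∈ X) :
    IsKFace 1 (convexHull ℝ S) (segment ℝ v w) ↔ IsEdgeSet S v w := by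
  rw [isKFace_convexHull_iff]
  constructor
  · rintro ⟨T, hT, hk, h⟩
    have hTX := hT.subset.trans hS
    have h1 : v ∈ T := hX.mem_of_mem_convexHull hTX hv (h ▸ left_mem_segment ℝ v w)
    have h2 : w ∈ T := hX.mem_of_mem_convexHull hTX hw (h ▸ right_mem_segment ℝ v w)
    have h3 : T = {v, w} := by
      apply Set.Subset.antisymm
      · intro x hx
        refine hX.mem_of_mem_convexHull (Set.pair_subset hv hw) (hTX hx) ?_
        rw [convexHull_pair, h]
        exact subset_convexHull ℝ _ hx
      · exact Set.pair_subset h1 h2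
    subst h3
    refine ⟨?_, hT⟩
    rintro rfl
    rw [Set.pair_eq_singleton, vectorSpan_singleton] at hk
    simp at hk
  · intro h
    exact ⟨{v, w}, h.2, finrank_vectorSpan_pair h.1, (convexHull_pair v w).symm⟩

/-- Of three collinear points one lies between the other two, which convex position forbids. -/
theorem ConvexPosition.exists_eq_pair [FiniteDimensional ℝ E] {X : Set E} (hX : ConvexPosition X)
    (h : Module.finrank ℝ (vectorSpan ℝ X) = 1) : ∃ a b, a ≠ b ∧ X = {a, b} := by
  have hnt : X.Nontrivial := by
    rw [← Set.not_subsingleton_iff]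
    intro hs
    rw [vectorSpan_of_subsingleton ℝ hs] at h
    simp at h
  obtain ⟨a, ha, b, hb, hab⟩ := hnt
  refine ⟨a, b, hab, Set.Subset.antisymm (fun c hc => ?_) (Set.pair_subset ha hb)⟩
  have hcol : Collinear ℝ X := collinear_iff_finrank_le_one.2 h.le
  have hcol3 : Collinear ℝ {a, b, c} := hcol.subset (by
    rintro x (rfl | rfl | rfl) <;> assumption)
  have key : ∀ x ∈ X, ∀ y ∈ X, ∀ z ∈ X, Wbtw ℝ x y z → y = x ∨ y = z := by
    intro x hx y hy z hz hw
    have := hX.mem_of_mem_convexHull (Set.pair_subset hx hz) hy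
      (by rw [convexHull_pair]; exact hw.mem_segment)
    simpa using this
  rcases hcol3.wbtw_or_wbtw_or_wbtw with h1 | h1 | h1
  · have := key _ ha _ hb _ hc h1
    grind
  · have := key _ hb _ hc _ ha h1
    grind
  · have := key _ hc _ ha _ hb h1
    grind

end ConvexGeometry

/-! ### Vertex figures and generic linear functionals -/

section VertexFigures

variable {E : Type*} [NormedAddCommGroup E] [NormedSpace ℝ E]

/-- The central projection of `x` from `v` to a hyperplane parallel to the kernel of `l`. -/
noncomputable def radial (l : StrongDual ℝ E) (v x : E) : E :=
  (l v - l x)⁻¹ • (x - v)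

/-- The projections of the points of `X` other than `v` from `v`. -/
noncomputable def link (l : StrongDual ℝ E) (v : E) (X : Set E) : Set E :=
  radial l v '' (X \ {v})

/-- `Y` is the vertex set of the vertex figure of `X` at `v`, taken in direction `l`. -/
structure IsVertexFigure (X : Set E) (v : E) (l : StrongDual ℝ E) (Y : Set E) : Prop where
  mem : v ∈ X
  lt : ∀ x ∈ X, x ≠ v → l x < l v
  subset : Y ⊆ link l v X
  convexPosition : ConvexPosition Y
  hull : convexHull ℝ Y = convexHull ℝ (link l v X)

theorem exists_isVertexFigure {X : Set E} (hfin : X.Finite) {v : E} {l : StrongDual ℝ E}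
    (hv : v ∈ X) (hl : ∀ x ∈ X, x ≠ v → l x < l v) : ∃ Y, IsVertexFigure X v l Y := by
  obtain ⟨Y, h1, h2, h3⟩ := exists_convexPosition_subset
    (Y := link l v X) ((hfin.subset Set.sdiff_subset).image _)
  exact ⟨Y, hv, hl, h1, h2, h3⟩

theorem map_radial (m l : StrongDual ℝ E) (v x : E) :
    m (radial l v x) = (l v - l x)⁻¹ * (m x - m v) := by
  simp [radial]

theorem map_radial_self {l : StrongDual ℝ E} {v x : E} (h : l x < l v) :
    l (radial l v x) = -1 := by
  rw [map_radial]
  have : l v - l x ≠ 0 := (sub_pos.2 h).ne'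
  field_simp
  ring

theorem map_radial_neg_iff (m : StrongDual ℝ E) {l : StrongDual ℝ E} {v x : E} (h : l x < l v) :
    m (radial l v x) < 0 ↔ m x < m v := by
  rw [map_radial, mul_neg_iff]
  have h1 : 0 < (l v - l x)⁻¹ := inv_pos.2 (sub_pos.2 h)
  simp [h1, h1.not_gt]

theorem map_radial_eq_zero_iff (m : StrongDual ℝ E) {l : StrongDual ℝ E} {v x : E}
    (h : l x < l v) : m (radial l v x) = 0 ↔ m x = m v := by
  rw [map_radial, mul_eq_zero, inv_eq_zero, sub_eq_zero, sub_eq_zero]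
  simp [h.ne']

/-- The link spans the direction of `X`, since its points are positive multiples of the vectors `x -
v`. It lies in the hyperplane `l = -1`, which misses the origin, so its linear span exceeds its
direction by one dimension. -/
theorem finrank_vectorSpan_eq_link_add_one [FiniteDimensional ℝ E] {X : Set E} {v : E}
    {l : StrongDual ℝ E} (hv : v ∈ X) (hl : ∀ x ∈ X, x ≠ v → l x < l v)
    (hne : (link l v X).Nonempty) :
    Module.finrank ℝ (vectorSpan ℝ X) = Module.finrank ℝ (vectorSpan ℝ (link l v X)) + 1 := by
  obtain ⟨y, hy⟩ := hne
  have hl1 : ∀ z ∈ link l v X, l z = -1 := by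
    rintro _ ⟨x, hx, rfl⟩
    exact map_radial_self (hl x hx.1 hx.2)
  have h1 : vectorSpan ℝ X = Submodule.span ℝ (link l v X) := by
    rw [vectorSpan_eq_span_vsub_set_right ℝ hv]
    apply le_antisymm <;> rw [Submodule.span_le]
    · rintro _ ⟨x, hx, rfl⟩
      by_cases hxv : x = v
      · simp [hxv]
      · have h2 : x -ᵥ v = (l v - l x) • radial l v x := by
          rw [radial, smul_inv_smul₀ (sub_pos.2 (hl x hx hxv)).ne', vsub_eq_sub]
        simp only [h2]
        exact Submodule.smul_mem _ _ (Submodule.subset_span ⟨x, ⟨hx, hxv⟩, rfl⟩)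
    · rintro _ ⟨x, hx, rfl⟩
      exact Submodule.smul_mem _ _ (Submodule.subset_span ⟨x, hx.1, rfl⟩)
  have h2 : Submodule.span ℝ (link l v X) = vectorSpan ℝ (link l v X) ⊔ Submodule.span ℝ {y} := by
    apply le_antisymm
    · rw [Submodule.span_le]
      intro z hz
      have : z = (z -ᵥ y) + y := by simp
      rw [this]
      exact Submodule.add_mem_sup (vsub_mem_vectorSpan ℝ hz hy)
        (Submodule.mem_span_singleton_self y)
    · refine sup_le ?_ ?_
      · rw [vectorSpan_eq_span_vsub_set_right ℝ hy, Submodule.span_le]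
        rintro _ ⟨z, hz, rfl⟩
        exact Submodule.sub_mem _ (Submodule.subset_span hz) (Submodule.subset_span hy)
      · rw [Submodule.span_le]
        simpa using Submodule.subset_span hy
  have h3 : vectorSpan ℝ (link l v X) ≤ LinearMap.ker l.toLinearMap := by
    rw [vectorSpan_eq_span_vsub_set_right ℝ hy, Submodule.span_le]
    rintro _ ⟨z, hz, rfl⟩
    simp [hl1 z hz, hl1 y hy]
  have h4 : vectorSpan ℝ (link l v X) ⊓ Submodule.span ℝ {y} = ⊥ := by
    rw [eq_bot_iff]
    rintro z ⟨hz1, hz2⟩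
    obtain ⟨t, rfl⟩ := Submodule.mem_span_singleton.1 hz2
    have := h3 hz1
    simp [hl1 y hy] at this
    simp [this]
  have hy0 : y ≠ 0 := by
    rintro rfl
    have := hl1 0 hy
    simp at this
  have h5 := Submodule.finrank_sup_add_finrank_inf_eq (vectorSpan ℝ (link l v X))
    (Submodule.span ℝ {y})
  rw [h4, finrank_span_singleton hy0, finrank_bot] at h5
  rw [h1, h2]
  exact h5

/-- As `l = -1` on the link, `m ≤ c` there is the homogeneous inequality `m + c • l ≤ 0`, which
survives rescaling to `x - v`. The last clause uses the hull of `T` because a link point need not be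
a vertex of the figure. -/
theorem IsVertexFigure.exists_isFaceSet [FiniteDimensional ℝ E] {X Y T : Set E} {v : E}
    {l : StrongDual ℝ E} (h : IsVertexFigure X v l Y) (hT : IsFaceSet Y T) :
    ∃ S, IsFaceSet X S ∧ v ∈ S ∧
      Module.finrank ℝ (vectorSpan ℝ S) = Module.finrank ℝ (vectorSpan ℝ T) + 1 ∧
      ∀ x ∈ X, x ≠ v → (x ∈ S ↔ radial l v x ∈ convexHull ℝ T) := by
  obtain ⟨hne, m, c, hm, rfl⟩ := hT
  have hmL : ∀ y ∈ link l v X, m y ≤ c := fun y hy =>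
    le_of_mem_convexHull m hm (h.hull ▸ subset_convexHull ℝ _ hy)
  have hconv : convexHull ℝ {y ∈ Y | m y = c} = convexHull ℝ {y ∈ link l v X | m y = c} := by
    rw [convexHull_sep_eq m hm, convexHull_sep_eq m hmL, h.hull]
  have key : ∀ x ∈ X, x ≠ v → (m + c • l) x =
      (m + c • l) v + (l v - l x) * (m (radial l v x) - c) := by
    intro x hx hxv
    have := (sub_pos.2 (h.lt x hx hxv)).ne'
    rw [map_radial]
    simp only [add_apply, smul_apply, smul_eq_mul]
    field_simp
    ring
  have hmem : ∀ x ∈ X, x ≠ v → ((m + c • l) x = (m + c • l) v ↔ m (radial l v x) = c) := by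
    intro x hx hxv
    have := (sub_pos.2 (h.lt x hx hxv)).ne'
    rw [key x hx hxv]
    simp [this, sub_eq_zero]
  have hSl : link l v {x ∈ X | (m + c • l) x = (m + c • l) v} = {y ∈ link l v X | m y = c} := by
    ext y
    constructor
    · rintro ⟨x, ⟨⟨hx, hx1⟩, hxv⟩, rfl⟩
      exact ⟨⟨x, ⟨hx, hxv⟩, rfl⟩, (hmem x hx hxv).1 hx1⟩
    · rintro ⟨⟨x, ⟨hx, hxv⟩, rfl⟩, hy⟩
      exact ⟨x, ⟨⟨hx, (hmem x hx hxv).2 hy⟩, hxv⟩, rfl⟩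
  refine ⟨{x ∈ X | (m + c • l) x = (m + c • l) v}, ⟨⟨v, h.mem, rfl⟩, m + c • l, (m + c • l) v, ?_,
    rfl⟩, ⟨h.mem, rfl⟩, ?_, ?_⟩
  · intro x hx
    by_cases hxv : x = v
    · rw [hxv]
    · rw [key x hx hxv]
      have h1 := sub_pos.2 (h.lt x hx hxv)
      have h2 := hmL _ ⟨x, ⟨hx, hxv⟩, rfl⟩
      nlinarith
  · rw [finrank_vectorSpan_eq_link_add_one (X := {x ∈ X | (m + c • l) x = (m + c • l) v}) (l := l)
      ⟨h.mem, rfl⟩ (fun x hx => h.lt x hx.1), hSl,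
      ← vectorSpan_convexHull, ← hconv, vectorSpan_convexHull]
    rw [hSl]
    exact (convexHull_nonempty_iff (𝕜 := ℝ)).1 (hconv ▸ convexHull_nonempty_iff.2 hne)
  · intro x hx hxv
    rw [hconv, convexHull_sep_eq m hmL]
    constructor
    · intro hxS
      exact ⟨subset_convexHull ℝ _ ⟨x, ⟨hx, hxv⟩, rfl⟩, (hmem x hx hxv).1 hxS.2⟩
    · intro hxS
      exact ⟨hx, (hmem x hx hxv).2 hxS.2⟩

theorem IsVertexFigure.exists_isEdgeSet [FiniteDimensional ℝ E] {X Y : Set E} {v y : E}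
    {l : StrongDual ℝ E} (hX : ConvexPosition X) (h : IsVertexFigure X v l Y) (hy : y ∈ Y) :
    ∃ w, IsEdgeSet X v w ∧ radial l v w = y := by
  obtain ⟨S, hS, hvS, hdim, hmem⟩ := h.exists_isFaceSet (h.convexPosition.isFaceSet_singleton hy)
  obtain ⟨a, b, hab, rfl⟩ := (hX.mono hS.subset).exists_eq_pair (by rw [hdim]; simp)
  have aux : ∀ w, v ≠ w → IsFaceSet X {v, w} → (∀ x ∈ X, x ≠ v → (x ∈ ({v, w} : Set E) ↔
      radial l v x ∈ convexHull ℝ {y})) → ∃ w, IsEdgeSet X v w ∧ radial l v w = y := by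
    intro w hvw hf hm
    refine ⟨w, ⟨hvw, hf⟩, ?_⟩
    simpa using (hm w (hf.subset (by simp)) hvw.symm).1 (by simp)
  rcases hvS with rfl | hvS
  · exact aux b hab hS hmem
  · obtain rfl : v = b := hvS
    rw [Set.pair_comm] at hS hmem
    exact aux a hab.symm hS hmem

theorem IsEdgeSet.exists_dual {X : Set E} {v w : E} (h : IsEdgeSet X v w) :
    ∃ m : StrongDual ℝ E, m w = m v ∧ ∀ x ∈ X, x ≠ v → x ≠ w → m x < m v := by
  obtain ⟨-, -, m, c, hm, hS⟩ := h
  have h1 : v ∈ {x ∈ X | m x = c} := hS ▸ by simp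
  have h2 : w ∈ {x ∈ X | m x = c} := hS ▸ by simp
  refine ⟨m, by rw [h1.2, h2.2], fun x hx hxv hxw => ?_⟩
  rw [h1.2]
  refine (hm x hx).lt_of_ne fun hxc => ?_
  have h3 : x ∈ ({v, w} : Set E) := hS ▸ ⟨hx, hxc⟩
  simp [hxv, hxw] at h3

theorem IsVertexFigure.radial_injective {X Y : Set E} {v w w' : E} {l : StrongDual ℝ E}
    (h : IsVertexFigure X v l Y) (hw : IsEdgeSet X v w) (hw' : IsEdgeSet X v w')
    (heq : radial l v w = radial l v w') : w = w' := by
  obtain ⟨m, hm, hlt⟩ := hw.exists_dual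
  by_contra hne
  have h1 := hlt w' hw'.right_mem hw'.1.symm (Ne.symm hne)
  have h2 := (map_radial_eq_zero_iff m (h.lt w hw.right_mem hw.1.symm)).2 hm
  rw [heq, map_radial_eq_zero_iff m (h.lt w' hw'.right_mem hw'.1.symm)] at h2
  exact h1.ne h2

/-- A functional exposing the edge vanishes at the projection of `w` and is negative at all other
link points, so the hull of `Y` could not reach this projection without containing it in `Y`. -/
theorem IsVertexFigure.radial_mem {X Y : Set E} {v w : E} {l : StrongDual ℝ E}
    (h : IsVertexFigure X v l Y) (hw : IsEdgeSet X v w) : radial l v w ∈ Y := by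
  obtain ⟨m, hm, hlt⟩ := hw.exists_dual
  by_contra hne
  have h1 : ∀ y ∈ Y, m y < 0 := by
    intro y hy
    obtain ⟨x, ⟨hx, hxv⟩, rfl⟩ := h.subset hy
    rw [map_radial_neg_iff m (h.lt x hx hxv)]
    exact hlt x hx hxv (fun e => hne (e ▸ hy))
  have h2 : radial l v w ∈ convexHull ℝ Y := by
    rw [h.hull]
    exact subset_convexHull ℝ _ ⟨w, ⟨hw.right_mem, hw.1.symm⟩, rfl⟩
  have h3 := lt_of_mem_convexHull m h1 h2
  rw [(map_radial_eq_zero_iff m (h.lt w hw.right_mem hw.1.symm)).2 hm] at h3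
  exact lt_irrefl _ h3

/-- A vertex that does not maximise `ψ` has a neighbour at which `ψ` is larger. -/
theorem ConvexPosition.exists_isEdgeSet_lt [FiniteDimensional ℝ E] {X : Set E}
    (hX : ConvexPosition X) (hfin : X.Finite) (ψ : StrongDual ℝ E) {v x : E} (hv : v ∈ X)
    (hx : x ∈ X) (hlt : ψ v < ψ x) : ∃ w, IsEdgeSet X v w ∧ ψ v < ψ w := by
  obtain ⟨l, hl⟩ := hX v hv
  obtain ⟨Y, hY⟩ := exists_isVertexFigure hfin hv hl
  have hxv : x ≠ v := by
    rintro rfl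
    exact lt_irrefl _ hlt
  -- Otherwise `ψ ≤ 0` on the hull of `Y`, hence at the projection of `x`, against `ψ v < ψ x`.
  obtain ⟨y, hy, hpos⟩ : ∃ y ∈ Y, 0 < ψ y := by
    by_contra! hcon
    have h1 := le_of_mem_convexHull (x := radial l v x) ψ hcon
      (hY.hull ▸ subset_convexHull ℝ _ ⟨x, ⟨hx, hxv⟩, rfl⟩)
    rw [map_radial] at h1
    have h2 : 0 < (l v - l x)⁻¹ := inv_pos.2 (sub_pos.2 (hl x hx hxv))
    nlinarith [mul_pos h2 (sub_pos.2 hlt)]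
  obtain ⟨w, hw, rfl⟩ := hY.exists_isEdgeSet hX hy
  refine ⟨w, hw, ?_⟩
  have h1 := (map_radial_neg_iff (-ψ) (hl w hw.right_mem hw.1.symm)).1 (by simpa using hpos)
  simpa using h1

/-- A vertex of a polygon lies on exactly two edges. -/
theorem ConvexPosition.exists_two_isEdgeSet [FiniteDimensional ℝ E] {S : Set E}
    (hS : ConvexPosition S) (hfin : S.Finite) (hdim : Module.finrank ℝ (vectorSpan ℝ S) = 2)
    {v : E} (hv : v ∈ S) :
    ∃ a b, a ≠ b ∧ ∀ w, IsEdgeSet S v w ↔ w = a ∨ w = b := by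
  obtain ⟨l, hl⟩ := hS v hv
  obtain ⟨Y, hY⟩ := exists_isVertexFigure hfin hv hl
  have hne : (link l v S).Nonempty := by
    by_contra hcon
    have h1 : S ⊆ {v} := by
      intro x hx
      by_contra hxv
      exact hcon ⟨_, x, ⟨hx, hxv⟩, rfl⟩
    rw [vectorSpan_of_subsingleton ℝ (Set.subsingleton_singleton.anti h1)] at hdim
    simp at hdim
  have h1 := finrank_vectorSpan_eq_link_add_one hv hl hne
  rw [hdim, ← vectorSpan_convexHull, ← hY.hull, vectorSpan_convexHull] at h1
  obtain ⟨y, z, hyz, rfl⟩ := hY.convexPosition.exists_eq_pair (by omega)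
  obtain ⟨a, ha, rfl⟩ := hY.exists_isEdgeSet hS (y := y) (by simp)
  obtain ⟨b, hb, rfl⟩ := hY.exists_isEdgeSet hS (y := z) (by simp)
  refine ⟨a, b, fun e => hyz (e ▸ rfl), fun w => ⟨fun hw => ?_, ?_⟩⟩
  · rcases hY.radial_mem hw with h2 | h2
    · exact Or.inl (hY.radial_injective hw ha h2)
    · exact Or.inr (hY.radial_injective hw hb h2)
  · rintro (rfl | rfl) <;> assumption

/-- Used both for paths in a vertex figure and for the connectedness of a polygon. -/
theorem reflTransGen_of_descent {α : Type*} {Y : Set α} (hY : Y.Finite) (f : α → ℝ)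
    {r : α → α → Prop} {z : α}
    (h : ∀ y ∈ Y, y ≠ z → ∃ y' ∈ Y, f y' < f y ∧ r y y') {y : α} (hy : y ∈ Y) :
    Relation.ReflTransGen r y z := by
  induction hn : {x ∈ Y | f x < f y}.ncard using Nat.strong_induction_on generalizing y with
  | _ n ih =>
    by_cases hyz : y = z
    · rw [hyz]
    · obtain ⟨y', hy', hlt, hr⟩ := h y hy hyz
      refine Relation.ReflTransGen.head hr (ih _ ?_ hy' rfl)
      rw [← hn]
      refine Set.ncard_lt_ncard ?_ (hY.subset (Set.sep_subset _ _))
      refine ⟨fun x hx => ⟨hx.1, hx.2.trans hlt⟩, fun hsub => ?_⟩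
      exact lt_irrefl _ (hsub (⟨hy', hlt⟩ : y' ∈ {x ∈ Y | f x < f y})).2

/-- `v, a` and `v, b` are the two edges at `v` of some `2`-face, and `φ` decreases along both. -/
def IsDownCorner (X : Set E) (φ : StrongDual ℝ E) (v a b : E) : Prop :=
  φ a < φ v ∧ φ b < φ v ∧ a ≠ b ∧ ∃ S, IsFaceSet X S ∧ Module.finrank ℝ (vectorSpan ℝ S) = 2 ∧
    IsEdgeSet S v a ∧ IsEdgeSet S v b

/-- The edges at `v` along which a generic functional decreases are linked by `2`-faces. -/
theorem IsVertexFigure.exists_reflTransGen [FiniteDimensional ℝ E] {X Y : Set E} {v : E}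
    {l : StrongDual ℝ E} (hX : ConvexPosition X) (hfin : X.Finite) (h : IsVertexFigure X v l Y)
    (φ : StrongDual ℝ E) (hφ : Set.InjOn φ (link l v X)) :
    ∃ z, ∀ w, IsEdgeSet X v w → φ w < φ v →
      Relation.ReflTransGen (IsDownCorner X φ v) w z := by
  set D : Set E := {w | IsEdgeSet X v w ∧ φ w < φ v} with hD
  have hDfin : D.Finite := hfin.subset fun w hw => hw.1.right_mem
  have hYfin : Y.Finite := ((hfin.subset Set.sdiff_subset).image _).subset h.subset
  by_cases hDne : D.Nonempty
  swap
  -- Without descending edges the claim is vacuous and `v` is an arbitrary value.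
  · exact ⟨v, fun w h1 h2 => absurd ⟨w, h1, h2⟩ hDne⟩
  obtain ⟨z, hz, hmin⟩ := hDfin.exists_minimalFor (fun w => φ (radial l v w)) _ hDne
  refine ⟨z, fun w h1 h2 => reflTransGen_of_descent hDfin (fun w => φ (radial l v w)) ?_
    (show w ∈ D from ⟨h1, h2⟩)⟩
  rintro a ⟨ha, hav⟩ haz
  have haY := h.radial_mem ha
  have hzY := h.radial_mem hz.1
  have hlt : φ (radial l v z) < φ (radial l v a) := by
    rcases lt_or_ge (φ (radial l v z)) (φ (radial l v a)) with h3 | h3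
    · exact h3
    · have h4 := hφ (h.subset haY) (h.subset hzY) (h3.antisymm (hmin ⟨ha, hav⟩ h3))
      exact absurd (h.radial_injective ha hz.1 h4) haz
  -- A simplex step in the vertex figure. The value drops further below zero, so the edge of the
  -- polytope over the new vertex descends too.
  obtain ⟨y, hay, hlt2⟩ := h.convexPosition.exists_isEdgeSet_lt hYfin (-φ) haY hzY (by simpa)
  obtain ⟨b, hb, rfl⟩ := h.exists_isEdgeSet hX hay.right_mem
  have hlt3 : φ (radial l v b) < φ (radial l v a) := by simpa using hlt2
  have hbv : φ b < φ v := by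
    have h1 := h.lt a ha.right_mem ha.1.symm
    have h2 := h.lt b hb.right_mem hb.1.symm
    rw [← map_radial_neg_iff φ h2]
    exact hlt3.trans ((map_radial_neg_iff φ h1).2 hav)
  refine ⟨b, ⟨hb, hbv⟩, hlt3, hav, hbv, ?_, ?_⟩
  · rintro rfl
    exact lt_irrefl _ hlt3
  obtain ⟨S, hS, hvS, hdim, hmem⟩ := h.exists_isFaceSet hay.2
  have haS : a ∈ S := (hmem a ha.right_mem ha.1.symm).2 (subset_convexHull ℝ _ (by simp))
  have hbS : b ∈ S := (hmem b hb.right_mem hb.1.symm).2 (subset_convexHull ℝ _ (by simp))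
  refine ⟨S, hS, by rw [hdim, finrank_vectorSpan_pair hay.1], ⟨ha.1, ?_⟩, ⟨hb.1, ?_⟩⟩
  · exact ha.2.of_subset (Set.pair_subset hvS haS) hS.subset
  · exact hb.2.of_subset (Set.pair_subset hvS hbS) hS.subset

/-- The top vertex of a down corner is the maximiser of `φ` on the `2`-face. -/
theorem ConvexPosition.le_of_isEdgeSet [FiniteDimensional ℝ E] {S : Set E}
    (hS : ConvexPosition S) (hfin : S.Finite) (hdim : Module.finrank ℝ (vectorSpan ℝ S) = 2)
    {φ : StrongDual ℝ E} {v a b : E} (ha : IsEdgeSet S v a) (hb : IsEdgeSet S v b) (hab : a ≠ b)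
    (hav : φ a < φ v) (hbv : φ b < φ v) {x : E} (hx : x ∈ S) : φ x ≤ φ v := by
  by_contra! hlt
  obtain ⟨w, hw, hvw⟩ := hS.exists_isEdgeSet_lt hfin φ ha.left_mem hx hlt
  obtain ⟨c, d, hcd, h⟩ := hS.exists_two_isEdgeSet hfin hdim ha.left_mem
  have h1 := (h a).1 ha
  have h2 := (h b).1 hb
  have h3 := (h w).1 hw
  have h4 : w = a ∨ w = b := by grind
  rcases h4 with rfl | rfl
  · exact lt_asymm hvw hav
  · exact lt_asymm hvw hbv

/-- The functional only has to avoid vanishing on finitely many nonzero differences. -/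
theorem exists_injOn_link [FiniteDimensional ℝ E] {X : Set E} (hfin : X.Finite)
    (l : E → StrongDual ℝ E) :
    ∃ φ : StrongDual ℝ E, Set.InjOn φ X ∧ ∀ v ∈ X, Set.InjOn φ (link (l v) v X) := by
  set Z : Set E := X ∪ ⋃ v ∈ X, link (l v) v X with hZ
  have hZfin : Z.Finite :=
    hfin.union (hfin.biUnion fun v _ => (hfin.subset Set.sdiff_subset).image _)
  have : Finite Z := hZfin
  obtain ⟨φ, hφ⟩ := Module.exists_dual_forall_apply_ne_zero (K := ℝ)
    (fun p : {p : Z × Z // (p.1 : E) ≠ p.2} => (p.1.1 : E) - p.1.2)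
    (fun p => sub_ne_zero.2 p.2)
  have hinj : Set.InjOn φ Z := by
    intro x hx y hy hxy
    by_contra hne
    exact hφ ⟨(⟨x, hx⟩, ⟨y, hy⟩), hne⟩ (by simp [hxy])
  refine ⟨LinearMap.toContinuousLinearMap φ, hinj.mono Set.subset_union_left, fun v hv => ?_⟩
  exact hinj.mono ((Set.subset_biUnion_of_mem (u := fun v => link (l v) v X) hv).trans
    Set.subset_union_right)

end VertexFigures

/-! ### Sweeping the cycle space of a graph by height -/

section Sweep

variable {V : Type*}

/-- The vectors supported on edges both of whose ends have height less than `t`. -/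
def lowSpace (G : SimpleGraph V) (f : V → ℝ) (t : ℝ) :
    Submodule (ZMod 2) (G.edgeSet → ZMod 2) where
  carrier := {x | ∀ e : G.edgeSet, ∀ u ∈ (e : Sym2 V), t ≤ f u → x e = 0}
  zero_mem' := fun _ _ _ _ => rfl
  add_mem' := fun hx hy e u hu ht => by simp [hx e u hu ht, hy e u hu ht]
  smul_mem' := fun c x hx e u hu ht => by simp [hx e u hu ht]

open Classical in
/-- The indicator vector of the edge `vw`. -/
noncomputable def edgeIndicator (G : SimpleGraph V) (v w : V) : G.edgeSet → ZMod 2 :=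
  fun e => if (e : Sym2 V) = s(v, w) then 1 else 0

/-- Exchanging every edge at the top vertex `v` for `vz` costs only elements of `M` and lower edges;
the copies of `vz` are even in number and cancel. -/
theorem mem_sup_lowSpace [Finite V] {G : SimpleGraph V} {f : V → ℝ} (hf : Function.Injective f)
    {M : Submodule (ZMod 2) (G.edgeSet → ZMod 2)} {t : ℝ} {v z : V}
    (hmax : ∀ u, f u < t → f u ≤ f v)
    (hz : ∀ w, G.Adj v w → f w < f v →
      edgeIndicator G v w - edgeIndicator G v z ∈ M ⊔ lowSpace G f (f v))
    {x : G.edgeSet → ZMod 2} (hx : x ∈ cycleSpace G) (hxt : x ∈ lowSpace G f t) :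
    x ∈ M ⊔ lowSpace G f (f v) := by
  classical
  obtain ⟨H, hHG, hH, rfl⟩ := hx
  obtain ⟨hNfin, hNeven⟩ := hH v
  set N := hNfin.toFinset with hN
  have hmemN : ∀ w, w ∈ N ↔ H.Adj v w := by simp [hN]
  have hlow : ∀ w ∈ N, f w < f v := by
    intro w hw
    have hadj := (hmemN w).1 hw
    have h1 : f w < t := by
      by_contra! hcon
      have := hxt ⟨s(v, w), hHG hadj⟩ w (by simp) hcon
      simp [edgeVec, hadj] at this
    exact (hmax w h1).lt_of_ne fun e => hadj.ne (hf e).symm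
  have hsum : ∑ w ∈ N, edgeIndicator G v w ∈ M ⊔ lowSpace G f (f v) := by
    have h1 : ∑ w ∈ N, (edgeIndicator G v w - edgeIndicator G v z) =
        ∑ w ∈ N, edgeIndicator G v w := by
      rw [Finset.sum_sub_distrib, Finset.sum_const]
      rw [Set.ncard_eq_toFinset_card _ hNfin] at hNeven
      obtain ⟨k, hk⟩ := hNeven
      rw [← hN] at hk
      rw [hk, ← two_mul, mul_smul, two_nsmul]
      funext e
      simp [CharTwo.add_self_eq_zero]
    rw [← h1]
    exact Submodule.sum_mem _ fun w hw => hz w (hHG ((hmemN w).1 hw)) (hlow w hw)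
  -- Once the edges at `v` are removed, injectivity of `f` puts all remaining ends strictly below
  -- `v`.
  have hdiff : edgeVec G H - ∑ w ∈ N, edgeIndicator G v w ∈ lowSpace G f (f v) := by
    rintro ⟨e, he⟩ u hu hvu
    simp only [Pi.sub_apply, Finset.sum_apply, edgeIndicator]
    by_cases hve : v ∈ e
    · obtain ⟨a, rfl⟩ := hve
      have h2 : ∀ w, s(v, a) = s(v, w) ↔ a = w := by simp
      simp only [h2, Finset.sum_ite_eq, hmemN, edgeVec, SimpleGraph.mem_edgeSet, sub_self]
    · have h2 : ∀ w, e ≠ s(v, w) := by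
        rintro w rfl
        simp at hve
      simp only [h2, if_false, Finset.sum_const_zero, sub_zero]
      refine hxt ⟨e, he⟩ u hu ?_
      by_contra! hut
      have := hf ((hmax u hut).antisymm hvu)
      exact hve (this ▸ hu)
  rw [← sub_add_cancel (edgeVec G H) (∑ w ∈ N, edgeIndicator G v w)]
  exact Submodule.add_mem _ (Submodule.mem_sup_right hdiff) hsum

/-- A subspace of the cycle space in which, at each vertex, the descending edges can be exchanged
modulo edges lying lower is the whole cycle space. -/
theorem cycleSpace_eq_of_exchange [Finite V] {G : SimpleGraph V} {f : V → ℝ}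
    (hf : Function.Injective f) {M : Submodule (ZMod 2) (G.edgeSet → ZMod 2)}
    (hM : M ≤ cycleSpace G)
    (h : ∀ v, ∃ z, ∀ w, G.Adj v w → f w < f v →
      edgeIndicator G v w - edgeIndicator G v z ∈ M ⊔ lowSpace G f (f v)) :
    cycleSpace G = M := by
  have key : ∀ n : ℕ, ∀ t : ℝ, {u | f u < t}.ncard = n → ∀ x ∈ cycleSpace G,
      x ∈ lowSpace G f t → x ∈ M := by
    intro n
    induction n using Nat.strong_induction_on with
    | _ n ih =>
      intro t hn x hx hxt
      by_cases hne : {u | f u < t}.Nonempty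
      · obtain ⟨v, hv, hmax⟩ := (Set.toFinite {u | f u < t}).exists_maximalFor f _ hne
        have hmax' : ∀ u, f u < t → f u ≤ f v := fun u hu =>
          (le_total (f u) (f v)).elim id fun h1 => hmax hu h1
        obtain ⟨z, hz⟩ := h v
        obtain ⟨m, hm, k, hk, rfl⟩ :=
          Submodule.mem_sup.1 (mem_sup_lowSpace hf hmax' hz hx hxt)
        refine Submodule.add_mem _ hm (ih _ ?_ (f v) rfl k ?_ hk)
        · rw [← hn]
          refine Set.ncard_lt_ncard ?_
          exact ⟨fun u (hu : f u < f v) => hu.trans hv, fun hsub => lt_irrefl (f v) (hsub hv)⟩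
        -- The lower remainder is again even, because `M` lies in the cycle space.
        · simpa using Submodule.sub_mem _ hx (hM hm)
      · have : x = 0 := by
          funext ⟨e, he⟩
          induction e with | _ a b =>
          exact hxt ⟨s(a, b), he⟩ a (by simp) (not_lt.1 fun ha => hne ⟨a, ha⟩)
        rw [this]
        exact Submodule.zero_mem _
  refine le_antisymm (fun x hx => ?_) hM
  obtain ⟨t, ht⟩ := (Set.finite_range f).bddAbove
  -- A bound may be attained; raising it by one puts every vertex strictly below.
  refine key _ (t + 1) rfl x hx fun e u _ hu => ?_
  have := ht ⟨u, rfl⟩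
  linarith

end Sweep

/-! ### Boundary cycles of 2-faces and the exchange of edges -/

section Polygons

variable {E : Type*} [NormedAddCommGroup E] [NormedSpace ℝ E]

theorem Vertex.ext_iff {P : Set E} {v w : Vertex P} : v = w ↔ v.1 = w.1 :=
  Subtype.ext_iff

theorem facialCycles_subset_cycleSpace (P : Set E) :
    facialCycles P ⊆ (cycleSpace (graph P) : Set ((graph P).edgeSet → ZMod 2)) := by
  rintro _ ⟨u, C, ⟨hC, -⟩, rfl⟩
  refine ⟨_, C.toSubgraph.spanningCoe_le, fun v => ⟨C.finite_neighborSet_toSubgraph, ?_⟩, rfl⟩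
  by_cases hne : (C.toSubgraph.spanningCoe.neighborSet v).Nonempty
  · rw [hC.isCycles_spanningCoe_toSubgraph hne]
    exact even_two
  · rw [Set.not_nonempty_iff_eq_empty.1 hne]
    simp

/-- The edges of the face set `S`, as a graph on all vertices of `P`. -/
def faceGraph (P S : Set E) : SimpleGraph (Vertex P) where
  Adj v w := IsEdgeSet S v.1 w.1
  symm := ⟨fun _ _ h => h.symm⟩
  loopless := ⟨fun _ h => h.1 rfl⟩

theorem ConvexPosition.finite_vertex {X : Set E} (hX : ConvexPosition X) (hfin : X.Finite) :
    Finite (Vertex (convexHull ℝ X)) := by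
  have : Finite X := hfin
  exact Finite.of_injective
    (fun v : Vertex (convexHull ℝ X) => (⟨v.1, hX.isKFace_zero_iff.1 v.2⟩ : X))
    fun v w h => Vertex.ext_iff.2 (congrArg (fun x : X => (x : E)) h)

theorem ConvexPosition.graph_eq {X : Set E} (hX : ConvexPosition X) :
    graph (convexHull ℝ X) = faceGraph (convexHull ℝ X) X := by
  ext v w
  exact hX.isKFace_one_iff subset_rfl (hX.isKFace_zero_iff.1 v.2) (hX.isKFace_zero_iff.1 w.2)

theorem ConvexPosition.faceGraph_le {X S : Set E} (hX : ConvexPosition X) (hfin : X.Finite)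
    (hS : IsFaceSet X S) : faceGraph (convexHull ℝ X) S ≤ graph (convexHull ℝ X) := by
  rw [hX.graph_eq]
  intro v w h
  exact ⟨h.1, hS.trans hfin h.2⟩

theorem ConvexPosition.ncard_neighborSet_faceGraph [FiniteDimensional ℝ E] {X S : Set E}
    (hX : ConvexPosition X) (hfin : X.Finite) (hS : IsFaceSet X S)
    (hdim : Module.finrank ℝ (vectorSpan ℝ S) = 2) {v : Vertex (convexHull ℝ X)}
    (hv : v.1 ∈ S) : ((faceGraph (convexHull ℝ X) S).neighborSet v).ncard = 2 := by
  obtain ⟨a, b, hab, h⟩ := (hX.mono hS.subset).exists_two_isEdgeSet (hfin.subset hS.subset) hdim hv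
  have hmem : ∀ c, c = a ∨ c = b → ∃ c' : Vertex (convexHull ℝ X), c'.1 = c := fun c hc =>
    ⟨⟨c, hX.isKFace_zero_iff.2 (hS.subset ((h c).2 hc).right_mem)⟩, rfl⟩
  obtain ⟨a, rfl⟩ := hmem a (Or.inl rfl)
  obtain ⟨b, rfl⟩ := hmem b (Or.inr rfl)
  refine Set.ncard_eq_two.2 ⟨a, b, fun e => hab (Vertex.ext_iff.1 e), ?_⟩
  ext w
  rw [Set.mem_insert_iff, Set.mem_singleton_iff, Vertex.ext_iff, Vertex.ext_iff]
  exact h w.1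

/-- The edges of a polygon form a cycle. -/
theorem ConvexPosition.edgeVec_faceGraph_mem [FiniteDimensional ℝ E] {X S : Set E}
    (hX : ConvexPosition X) (hfin : X.Finite) (hS : IsFaceSet X S)
    (hdim : Module.finrank ℝ (vectorSpan ℝ S) = 2) {φ : StrongDual ℝ E} (hφ : Set.InjOn φ X) :
    edgeVec (graph (convexHull ℝ X)) (faceGraph (convexHull ℝ X) S) ∈
      facialCycles (convexHull ℝ X) := by
  classical
  have := hX.finite_vertex hfin
  have := Fintype.ofFinite (Vertex (convexHull ℝ X))
  have hle := hX.faceGraph_le hfin hS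
  have hSfin := hfin.subset hS.subset
  have hSX := hX.mono hS.subset
  have hSV : ∀ x ∈ S, IsKFace 0 (convexHull ℝ X) {x} := fun x hx =>
    hX.isKFace_zero_iff.2 (hS.subset hx)
  set G := faceGraph (convexHull ℝ X) S with hG
  have hcyc : G.IsCycles := by
    rintro v ⟨w, hw⟩
    exact hX.ncard_neighborSet_faceGraph hfin hS hdim (IsEdgeSet.left_mem hw)
  obtain ⟨z, hz, hmin⟩ := hSfin.exists_minimalFor φ _ hS.1
  let z' : Vertex (convexHull ℝ X) := ⟨z, hSV z hz⟩
  have hreach : ∀ v : Vertex (convexHull ℝ X), v.1 ∈ S → G.Reachable v z' := by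
    intro v hv
    rw [SimpleGraph.reachable_iff_reflTransGen]
    refine reflTransGen_of_descent (Y := {v : Vertex (convexHull ℝ X) | v.1 ∈ S})
      (Set.toFinite _) (fun v => φ v.1) ?_ hv
    intro y hy hyz
    have hlt : φ z < φ y.1 := by
      rcases lt_or_ge (φ z) (φ y.1) with h | h
      · exact h
      · exact absurd (Subtype.ext (hφ (hS.subset hy) (hS.subset hz) (h.antisymm (hmin hy h)))) hyz
    obtain ⟨w, hw, hlt2⟩ := hSX.exists_isEdgeSet_lt hSfin (-φ) hy hz (by simpa)
    exact ⟨⟨w, hSV w hw.right_mem⟩, hw.right_mem, by simpa using hlt2, hw⟩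
  have hne : (G.neighborSet z').Nonempty := by
    apply Set.nonempty_of_ncard_ne_zero
    rw [hX.ncard_neighborSet_faceGraph hfin hS hdim hz]
    norm_num
  -- Degree two makes the component of `z'` a single cycle, and by `hreach` it contains every edge
  -- of the polygon.
  obtain ⟨p, hp, hverts⟩ := hcyc.exists_cycle_toSubgraph_verts_eq_connectedComponentSupp
    (c := G.connectedComponentMk z') rfl hne
  have hadj : ∀ v w, p.toSubgraph.Adj v w ↔ G.Adj v w := by
    intro v w
    refine ⟨fun h => h.adj_sub, fun h => ?_⟩
    refine (hp.adj_toSubgraph_iff_of_isCycles hcyc ?_ w).2 h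
    rw [hverts]
    exact SimpleGraph.ConnectedComponent.sound (hreach v (IsEdgeSet.left_mem h))
  refine ⟨z', p.mapLe hle, ⟨hp.mapLe hle, convexHull ℝ S,
    isKFace_convexHull_iff.2 ⟨S, hS, hdim, rfl⟩, fun v w => ?_⟩, ?_⟩
  · rw [SimpleGraph.Walk.edges_mapLe_eq_edges, ← SimpleGraph.Walk.mem_edges_toSubgraph,
      SimpleGraph.Subgraph.mem_edgeSet, hadj, hX.isKFace_one_iff hS.subset
      (hX.isKFace_zero_iff.1 v.2) (hX.isKFace_zero_iff.1 w.2)]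
    rfl
  · congr 1
    ext v w
    rw [SimpleGraph.Subgraph.spanningCoe_adj, SimpleGraph.Walk.adj_toSubgraph_mapLe, hadj]

/-- Over `GF(2)` signs are immaterial, and the boundary of the 2-face is `va + vb` plus edges
avoiding `v`; these lie below `v`, the unique maximiser of `φ` on the face. -/
theorem ConvexPosition.edgeIndicator_sub_mem [FiniteDimensional ℝ E] {X : Set E}
    (hX : ConvexPosition X) (hfin : X.Finite) {φ : StrongDual ℝ E} (hφ : Set.InjOn φ X)
    {v a b : Vertex (convexHull ℝ X)} (h : IsDownCorner X φ v.1 a.1 b.1) :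
    edgeIndicator (graph (convexHull ℝ X)) v a - edgeIndicator (graph (convexHull ℝ X)) v b ∈
      Submodule.span (ZMod 2) (facialCycles (convexHull ℝ X)) ⊔
        lowSpace (graph (convexHull ℝ X)) (fun u => φ u.1) (φ v.1) := by
  classical
  obtain ⟨hav, hbv, hab, S, hS, hdim, ha, hb⟩ := h
  have hSX := hX.mono hS.subset
  have hSfin := hfin.subset hS.subset
  have hmem := Submodule.subset_span (R := ZMod 2) (hX.edgeVec_faceGraph_mem hfin hS hdim hφ)
  obtain ⟨c, d, hcd, htwo⟩ := hSX.exists_two_isEdgeSet hSfin hdim ha.left_mem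
  rw [← sub_add_cancel (edgeIndicator _ v a - edgeIndicator _ v b)
    (edgeVec (graph (convexHull ℝ X)) (faceGraph (convexHull ℝ X) S))]
  refine Submodule.add_mem _ (Submodule.mem_sup_right ?_) (Submodule.mem_sup_left hmem)
  rintro ⟨e, he⟩ u hu hvu
  simp only [Pi.sub_apply, edgeIndicator, edgeVec]
  by_cases hve : v ∈ e
  · obtain ⟨w, rfl⟩ := hve
    have h1 : s(v, w) ∈ (faceGraph (convexHull ℝ X) S).edgeSet ↔ w = a ∨ w = b := by
      have h2 : s(v, w) ∈ (faceGraph (convexHull ℝ X) S).edgeSet ↔ IsEdgeSet S v.1 w.1 := Iff.rfl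
      rw [h2, htwo, Vertex.ext_iff, Vertex.ext_iff]
      have h3 := (htwo _).1 ha
      have h4 := (htwo _).1 hb
      grind
    have h2 : ∀ x, s(v, w) = s(v, x) ↔ w = x := by simp
    have hab' : a ≠ b := fun e => hab (e ▸ rfl)
    simp only [h1, h2]
    by_cases hwa : w = a <;> by_cases hwb : w = b
    · exact absurd (hwa.symm.trans hwb) hab'
    · simp [hwa, hab']
    · simp [hwb, hab'.symm]
    · simp [hwa, hwb]
  · have h1 : ∀ w, e ≠ s(v, w) := by
      rintro w rfl
      simp at hve
    have h2 : e ∉ (faceGraph (convexHull ℝ X) S).edgeSet := by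
      intro heS
      have huS : u.1 ∈ S := by
        induction e with | _ x y =>
        have heS' : IsEdgeSet S x.1 y.1 := heS
        rcases Sym2.mem_iff.1 hu with rfl | rfl
        · exact heS'.left_mem
        · exact heS'.right_mem
      have hle := hSX.le_of_isEdgeSet hSfin hdim ha hb hab hav hbv huS
      have huv : u = v := Subtype.ext
        (hφ (hS.subset huS) (hS.subset ha.left_mem) (hle.antisymm hvu))
      exact hve (huv ▸ hu)
    simp [h1, h2]

theorem ConvexPosition.cycleSpace_eq_span [FiniteDimensional ℝ E] {X : Set E}
    (hX : ConvexPosition X) (hfin : X.Finite) :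
    cycleSpace (graph (convexHull ℝ X)) =
      Submodule.span (ZMod 2) (facialCycles (convexHull ℝ X)) := by
  have := hX.finite_vertex hfin
  have hXV := fun {v : E} => hX.isKFace_zero_iff (v := v)
  choose! l hl using hX
  obtain ⟨φ, hφ, hφl⟩ := exists_injOn_link hfin l
  have hf : Function.Injective fun u : Vertex (convexHull ℝ X) => φ u.1 := fun u v h =>
    Subtype.ext (hφ (hXV.1 u.2) (hXV.1 v.2) h)
  refine cycleSpace_eq_of_exchange hf
    (Submodule.span_le.2 (facialCycles_subset_cycleSpace _)) fun v => ?_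
  have hX : ConvexPosition X := fun v hv => ⟨l v, hl v hv⟩
  have hvX := hXV.1 v.2
  obtain ⟨Y, hY⟩ := exists_isVertexFigure hfin hvX (hl v.1 hvX)
  obtain ⟨z, hz⟩ := hY.exists_reflTransGen hX hfin φ (hφl v.1 hvX)
  -- A descending edge would start a chain of vertices ending at `z`. If `z` is not a vertex there
  -- is none, and any vertex serves.
  by_cases hzX : z ∈ X
  swap
  · refine ⟨v, fun w hw hlt => absurd ?_ hzX⟩
    rw [hX.graph_eq] at hw
    rcases Relation.ReflTransGen.cases_tail (hz w.1 hw hlt) with h1 | ⟨c, -, -, -, -, S, hS, -, -, hb⟩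
    · exact h1 ▸ hw.right_mem
    · exact hS.subset hb.right_mem
  refine ⟨⟨z, hXV.2 hzX⟩, fun w hw hlt => ?_⟩
  rw [hX.graph_eq] at hw
  -- The differences telescope along the chain of down corners.
  have key : ∀ a, Relation.ReflTransGen (IsDownCorner X φ v.1) w.1 a →
      ∀ ha : IsKFace 0 (convexHull ℝ X) {a},
      edgeIndicator (graph (convexHull ℝ X)) v w -
        edgeIndicator (graph (convexHull ℝ X)) v ⟨a, ha⟩ ∈
      Submodule.span (ZMod 2) (facialCycles (convexHull ℝ X)) ⊔
        lowSpace (graph (convexHull ℝ X)) (fun u => φ u.1) (φ v.1) := by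
    intro a hwa
    induction hwa with
    | refl =>
      intro ha
      rw [show (⟨w.1, ha⟩ : Vertex (convexHull ℝ X)) = w from rfl, sub_self]
      exact Submodule.zero_mem _
    | @tail b c _ hbc ih =>
      intro hc
      have hb : IsKFace 0 (convexHull ℝ X) {b} := by
        obtain ⟨-, -, -, S, hS, -, hb, -⟩ := hbc
        exact hXV.2 (hS.subset hb.right_mem)
      have h1 := hX.edgeIndicator_sub_mem hfin hφ (v := v) (a := ⟨b, hb⟩) (b := ⟨c, hc⟩) hbc
      simpa using Submodule.add_mem _ (ih hb) h1
  exact key z (hz w.1 hw hlt) _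

end Polygons

end PolytopeGraph

theorem corollary2 (d : ℕ) (hd : 2 ≤ d) (n : ℕ) (P : Set (EuclideanSpace ℝ (Fin n)))
    (hP : PolytopeGraph.IsDPolytope d P) :
    PolytopeGraph.cycleSpace (PolytopeGraph.graph P) =
      Submodule.span (ZMod 2) (PolytopeGraph.facialCycles P) := by
  obtain ⟨⟨Y, rfl⟩, -⟩ := hP
  obtain ⟨X, hXY, hX, hconv⟩ := PolytopeGraph.exists_convexPosition_subset Y.finite_toSet
  rw [← hconv]
  exact hX.cycleSpace_eq_span (Y.finite_toSet.subset hXY)
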